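/- All Banach spaces are real. Let $C(2^{\mathbb N})$ be the Banach space of continuous real functions on the Cantor set with the supremum norm. Let $\mathrm{SB}$ be the set of all closed linear subspaces $X$ of $C(2^{\mathbb N})$, equipped with the (relative) Effros–Borel structure, that is, the $\sigma$-algebra generated by the sets $\{X\in\mathrm{SB}: X\cap U\neq\varnothing\}$, where $U$ ranges over the open subsets of $C(2^{\mathbb N})$; this is the standard Borel space of separable Banach spaces. A subset of $\mathrm{SB}$ is analytic if it is empty or the image of the Baire space $\mathbb N^{\mathbb N}$ under a Borel map $\mathbb N^{\mathbb N}\to\mathrm{SB}$. For a Banach space $Z$ let $\mathrm{NC}_Z$ be the set of all $X\in\mathrm{SB}$ which do not contain an isomorphic copy of $Z$, i.e. which have no subspace linearly homeomorphic to $Z$. A Banach space $Z$ is minimal if it is infinite-dimensional and every infinite-dimensional closed subspace of $Z$ contains an isomorphic copy of $Z$. A Banach space $X$ is a quotient of a Banach space $Y$ if there is a bounded linear operator from $Y$ onto $X$. Let $Z$ be a minimal Banach space which does not contain an isomorphic copy of $c_0$, and let $\mathcal A$ be an analytic subset of $\mathrm{NC}_Z\cap\mathrm{NC}_{\ell_1}$.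 Then there exists a subset $\mathcal B$ of $\mathrm{NC}_Z\cap\mathrm{NC}_{\ell_1}$ with the following properties. (i) The set $\mathcal B$ is analytic. (ii) Every $Y\in\mathcal B$ is infinite-dimensional and has a Schauder basis. (iii) For every $X\in\mathcal A$ there exists $Y\in\mathcal B$ such that $X$ is a quotient of $Y$. -/

import Mathlib

noncomputable section

/-- The Banach space `C(2^ℕ)` of real continuous functions on the Cantor set `2^ℕ`,
with the supremum norm. -/
abbrev CantorC : Type := C(ℕ → Bool, ℝ)

/-- `Y` contains an isomorphic copy of `Z`: some linear subspace of `Y` is linearly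
homeomorphic to `Z` (such a subspace is closed when `Z` is complete). -/
def ContainsCopy (Z Y : Type*) [NormedAddCommGroup Z] [NormedSpace ℝ Z]
    [NormedAddCommGroup Y] [NormedSpace ℝ Y] : Prop :=
  ∃ W : Submodule ℝ Y, Nonempty (Z ≃L[ℝ] W)

/-- `Z` is minimal: it is infinite-dimensional and each of its infinite-dimensional
closed subspaces contains an isomorphic copy of `Z`. -/
def IsMinimalSpace (Z : Type*) [NormedAddCommGroup Z] [NormedSpace ℝ Z] : Prop :=
  ¬ FiniteDimensional ℝ Z ∧
    ∀ W : Submodule ℝ Z, IsClosed (W : Set Z) → ¬ FiniteDimensional ℝ W → ContainsCopy Z W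

/-- `X` is a quotient of `Y`: there is a bounded linear operator from `Y` onto `X`. -/
def IsQuotientOf (X Y : Type*) [NormedAddCommGroup X] [NormedSpace ℝ X]
    [NormedAddCommGroup Y] [NormedSpace ℝ Y] : Prop :=
  ∃ Q : Y →L[ℝ] X, Function.Surjective Q

/-- The set of all closed linear subspaces of `C(2^ℕ)`. -/
def SB : Type := {X : Submodule ℝ CantorC // IsClosed (X : Set CantorC)}

/-- The Banach space which a point of `SB` is. -/
abbrev SB.space (X : SB) : Type := X.1

/-- The relative Effros Borel structure, generated by the sets `{X | X ∩ U ≠ ∅}`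
with `U` open in `C(2^ℕ)`. -/
instance SB.instMeasurableSpace : MeasurableSpace SB :=
  MeasurableSpace.generateFrom
    {S | ∃ U : Set CantorC, IsOpen U ∧ S = {X : SB | ((X.1 : Set CantorC) ∩ U).Nonempty}}

/-- Analytic subsets of a (standard Borel) measurable space: the empty set and the images of
the Baire space `ℕ^ℕ` under Borel maps. -/
def IsAnalyticSubset {S : Type*} [MeasurableSpace S] (A : Set S) : Prop :=
  A = ∅ ∨ ∃ f : (ℕ → ℕ) → S, Measurable f ∧ Set.range f = A

/-- The set of all `X` in `SB` that do not contain an isomorphic copy of `Z`. -/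
def NC (Z : Type*) [NormedAddCommGroup Z] [NormedSpace ℝ Z] : Set SB :=
  {X | ¬ ContainsCopy Z X.space}

/-- The Banach space `ℓ₁` of absolutely summable real sequences. -/
abbrev EllOne : Type := lp (fun _ : ℕ => ℝ) 1

/-- The Banach space `c₀` of real sequences converging to zero, with the supremum norm. -/
abbrev CZero : Type := ZeroAtInftyContinuousMap ℕ ℝ

end

open Filter Topology Set

/-! Given a sequence `d` in `C(2^ℕ)`, let e_n = `windowVector d n`. A point of the Cantor set codes
an interval I of ℕ and an evaluation point, so that ‖∑ a_n e_n‖ is the supremum over I of the norm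
of ∑_{n ∈ I} a_n (d_n, 1). The e_n form a monotone basis of their closed span `windowSpace d`, and
e_n ↦ d_n extends to a contraction Q, namely `pullback fullFalse`. If `d` is dense in the unit ball
of X, then Q maps onto X.

The crux is that a copy of Z in `windowSpace d` forces one in the closed span of `d`
(`ContainsCopy.of_windowSpace`). Suppose that Q is not bounded below on any finite-codimensional
part of the copy cut out by finitely many coordinates and the sum of the coefficients. A gliding
hump then gives normalized y_k, almost blocks of the basis, with Q y_k tiny. At a point with
interval I, y_k is small unless an endpoint of I cuts the k-th block, and each endpoint cuts at most
one block. So (y_k) is equivalent to the basis of c₀, which is excluded. Hence Q is bounded below on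
some such part, and Z embeds in that part. This applies both to a minimal Z without c₀ and to ℓ₁.

For analyticity, ℬ consists of the spaces `windowSpace d` for all `d` with closed span in 𝒜. The
relation between parameters and such `d` is Borel in a Polish space, and `d` ↦ `windowSpace d` is
Borel. -/

/-! ### Isomorphic copies and a criterion for c₀ -/

theorem containsCopy_of_le_norm {Z Y : Type*} [NormedAddCommGroup Z] [NormedSpace ℝ Z]
    [NormedAddCommGroup Y] [NormedSpace ℝ Y] (T : Z →L[ℝ] Y) {c : ℝ} (hc : 0 < c)
    (hT : ∀ z, c * ‖z‖ ≤ ‖T z‖) : ContainsCopy Z Y := by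
  have hinj : Function.Injective T.toLinearMap := by
    rw [← LinearMap.ker_eq_bot, LinearMap.ker_eq_bot']
    intro z hz
    have h := hT z
    rw [show T z = 0 from hz, norm_zero] at h
    exact norm_le_zero_iff.1 (nonpos_of_mul_nonpos_right h hc)
  refine ⟨LinearMap.range T.toLinearMap,
    ⟨(LinearEquiv.ofInjective T.toLinearMap hinj).toContinuousLinearEquivOfBounds ‖T‖ c⁻¹ ?_ ?_⟩⟩
  · exact fun z => T.le_opNorm z
  · intro w
    obtain ⟨z, rfl⟩ := (LinearEquiv.ofInjective T.toLinearMap hinj).surjective w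
    rw [LinearEquiv.symm_apply_apply, inv_mul_eq_div, le_div_iff₀ hc, mul_comm]
    exact hT z

theorem ContainsCopy.exists_le_norm {Z Y : Type*} [NormedAddCommGroup Z] [NormedSpace ℝ Z]
    [NormedAddCommGroup Y] [NormedSpace ℝ Y] (h : ContainsCopy Z Y) :
    ∃ (T : Z →L[ℝ] Y) (c : ℝ), 0 < c ∧ ∀ z, c * ‖z‖ ≤ ‖T z‖ := by
  obtain ⟨W, ⟨e⟩⟩ := h
  refine ⟨W.subtypeL.comp (e : Z →L[ℝ] W), (‖(e.symm : W →L[ℝ] Z)‖ + 1)⁻¹, by positivity, ?_⟩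
  intro z
  have h1 := (e.symm : W →L[ℝ] Z).le_opNorm (e z)
  rw [inv_mul_le_iff₀ (by positivity)]
  simp only [ContinuousLinearEquiv.coe_coe, ContinuousLinearEquiv.symm_apply_apply] at h1
  refine h1.trans ?_
  change _ ≤ _ * ‖e z‖
  gcongr
  linarith

theorem CZero.abs_apply_le (a : CZero) (k : ℕ) : |a k| ≤ ‖a‖ :=
  a.toBCF.norm_coe_le_norm k

theorem CZero.norm_le {a : CZero} {r : ℝ} (hr : 0 ≤ r) (h : ∀ k, |a k| ≤ r) : ‖a‖ ≤ r :=
  (BoundedContinuousFunction.norm_le hr).2 h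

/-- The upper estimate makes ∑ a_k z_k converge for every null sequence a and bounds the resulting
operator; the lower one bounds it below. -/
theorem containsCopy_cZero {Z : Type*} [NormedAddCommGroup Z] [NormedSpace ℝ Z] [CompleteSpace Z]
    (z : ℕ → Z) {c M : ℝ} (hc : 0 < c) (hM : 0 ≤ M)
    (upper : ∀ (F : Finset ℕ) (a : ℕ → ℝ) (r : ℝ), 0 ≤ r → (∀ k ∈ F, |a k| ≤ r) →
      ‖∑ k ∈ F, a k • z k‖ ≤ M * r)
    (lower : ∀ (F : Finset ℕ) (a : ℕ → ℝ) (k : ℕ), k ∈ F → c * |a k| ≤ ‖∑ k ∈ F, a k • z k‖) :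
    ContainsCopy CZero Z := by
  have hsum : ∀ a : CZero, Summable fun k => a k • z k := by
    intro a
    rw [summable_iff_vanishing_norm]
    intro ε hε
    have hr : 0 < ε / (M + 1) := by positivity
    have hev : ∀ᶠ k in cofinite, |a k| < ε / (M + 1) := by
      have := zero_at_infty a
      rw [cocompact_eq_cofinite] at this
      have := this.abs
      rw [abs_zero] at this
      exact this.eventually_lt_const hr
    rw [eventually_cofinite] at hev
    refine ⟨hev.toFinset, fun t ht => ?_⟩
    refine (upper t a (ε / (M + 1)) hr.le fun k hk => ?_).trans_lt ?_
    · by_contra h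
      exact Finset.disjoint_left.1 ht hk (by simpa using fun h' : |a k| < _ => h h'.le)
    · rw [mul_div_assoc', div_lt_iff₀ (by positivity)]
      nlinarith
  let T₀ : CZero →ₗ[ℝ] Z :=
    { toFun := fun a => ∑' k, a k • z k
      map_add' := fun a b => by
        rw [← (hsum a).tsum_add (hsum b)]
        simp [add_smul]
      map_smul' := fun s a => by
        simp only [RingHom.id_apply]
        rw [← (hsum a).tsum_const_smul]
        simp [smul_smul] }
  have hlim : ∀ a : CZero, Tendsto (fun F : Finset ℕ => ‖∑ k ∈ F, a k • z k‖) atTop (𝓝 ‖T₀ a‖) :=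
    fun a => (hsum a).hasSum.norm
  let T : CZero →L[ℝ] Z := T₀.mkContinuous M fun a =>
    le_of_tendsto' (hlim a) fun F => upper F a ‖a‖ (norm_nonneg a) fun k _ => a.abs_apply_le k
  refine containsCopy_of_le_norm T hc fun a => ?_
  have key : ∀ k, c * |a k| ≤ ‖T a‖ := fun k =>
    ge_of_tendsto (hlim a) ((eventually_ge_atTop {k}).mono fun F hF =>
      lower F a k (hF (Finset.mem_singleton_self k)))
  rw [mul_comm, ← le_div_iff₀ hc]
  refine CZero.norm_le (by positivity) fun k => ?_
  rw [le_div_iff₀ hc, mul_comm]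
  exact key k

/-! ### Embedding into finite-codimensional subspaces -/

/-- `Z` embeds into each of its subspaces of finite codimension. -/
def EmbedsInFiniteCodim (Z : Type*) [NormedAddCommGroup Z] [NormedSpace ℝ Z] : Prop :=
  ∀ (n : ℕ) (φ : Fin n → StrongDual ℝ Z), ∃ (S : Z →L[ℝ] Z) (c : ℝ), 0 < c ∧
    (∀ z, c * ‖z‖ ≤ ‖S z‖) ∧ ∀ i z, φ i (S z) = 0

theorem IsMinimalSpace.embedsInFiniteCodim {Z : Type*} [NormedAddCommGroup Z] [NormedSpace ℝ Z]
    (hZ : IsMinimalSpace Z) : EmbedsInFiniteCodim Z := by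
  intro n φ
  let Φ : Z →L[ℝ] (Fin n → ℝ) := ContinuousLinearMap.pi φ
  have hW : IsClosed ((LinearMap.ker Φ.toLinearMap : Submodule ℝ Z) : Set Z) := Φ.isClosed_ker
  have hinf : ¬ FiniteDimensional ℝ (LinearMap.ker Φ.toLinearMap) := by
    intro hfin
    refine hZ.1 ?_
    have := Module.Finite.equiv (Φ.toLinearMap.quotKerEquivRange).symm
    exact Module.Finite.of_submodule_quotient (LinearMap.ker Φ.toLinearMap)
  obtain ⟨S, c, hc, hS⟩ := (hZ.2 _ hW hinf).exists_le_norm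
  refine ⟨(Submodule.subtypeL _).comp S, c, hc, hS, fun i z => ?_⟩
  exact congrFun (LinearMap.mem_ker.1 (S z).2) i

theorem EllOne.hasSum_abs (x : EllOne) : HasSum (fun n => |x n|) ‖x‖ := by
  have := lp.hasSum_norm (p := 1) (by simp) x
  simpa using this

theorem EllOne.norm_eq_tsum (x : EllOne) : ‖x‖ = ∑' n, |x n| := x.hasSum_abs.tsum_eq.symm

theorem EllOne.hasSum_block {N : ℕ} [NeZero N] (w : ℕ → Fin N → ℝ) (hw : ∀ k, ∑ j, |w k j| = 1)
    (a : EllOne) :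
    HasSum (fun m => |a (Nat.divModEquiv N m).1 *
      w (Nat.divModEquiv N m).1 (Nat.divModEquiv N m).2|) ‖a‖ := by
  have h : ∀ k, ∑' j, |a k * w k j| = |a k| := by
    intro k
    simp [abs_mul, ← Finset.mul_sum, hw]
  have hs : Summable fun q : ℕ × Fin N => |a q.1 * w q.1 q.2| := by
    rw [summable_prod_of_nonneg fun _ => abs_nonneg _]
    refine ⟨fun k => (hasSum_fintype _).summable, ?_⟩
    simp only [h]
    exact a.hasSum_abs.summable
  have h2 : HasSum (fun q : ℕ × Fin N => |a q.1 * w q.1 q.2|) ‖a‖ := by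
    rw [hs.hasSum_iff, hs.tsum_prod]
    simp only [h]
    exact a.hasSum_abs.tsum_eq
  exact (Nat.divModEquiv N).hasSum_iff.2 h2

/-- The isometric embedding of `ℓ₁` into itself that sends the unit vectors to normalized
vectors carried by consecutive blocks of length `N`. -/
noncomputable def EllOne.blockEmbedding {N : ℕ} [NeZero N] (w : ℕ → Fin N → ℝ)
    (hw : ∀ k, ∑ j, |w k j| = 1) : EllOne →ₗᵢ[ℝ] EllOne where
  toFun a := ⟨fun m => a (Nat.divModEquiv N m).1 *
      w (Nat.divModEquiv N m).1 (Nat.divModEquiv N m).2, by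
    refine memℓp_gen ?_
    simpa [Real.norm_eq_abs] using (EllOne.hasSum_block w hw a).summable⟩
  map_add' a b := by
    ext m
    exact add_mul _ _ _
  map_smul' s a := by
    ext m
    exact mul_assoc _ _ _
  norm_map' a := by
    rw [EllOne.norm_eq_tsum]
    exact (EllOne.hasSum_block w hw a).tsum_eq

theorem EllOne.blockEmbedding_single {N : ℕ} [NeZero N] (w : ℕ → Fin N → ℝ)
    (hw : ∀ k, ∑ j, |w k j| = 1) (k : ℕ) :
    EllOne.blockEmbedding w hw (lp.single 1 k (1 : ℝ)) =
      ∑ j : Fin N, w k j • (lp.single 1 ((Nat.divModEquiv N).symm (k, j)) (1 : ℝ) : EllOne) := by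
  ext m
  obtain ⟨⟨k', j'⟩, rfl⟩ := (Nat.divModEquiv N).symm.surjective m
  rw [lp.coeFn_sum]
  change (lp.single 1 k (1 : ℝ) : EllOne) _ * w _ _ = _
  simp only [Equiv.apply_symm_apply, Finset.sum_apply, lp.coeFn_smul, Pi.smul_apply,
    lp.single_apply, Pi.single_apply, EmbeddingLike.apply_eq_iff_eq, Prod.mk.injEq, smul_eq_mul]
  by_cases hk : k' = k
  · subst hk
    simp
  · simp [hk]

/-- Each block of n + 1 unit vectors carries a normalized vector killed by all n functionals, and
disjoint normalized blocks span ℓ₁ isometrically. -/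
theorem EllOne.embedsInFiniteCodim : EmbedsInFiniteCodim EllOne := by
  intro n φ
  let e : ℕ → Fin (n + 1) → EllOne := fun k j =>
    lp.single 1 ((Nat.divModEquiv (n + 1)).symm (k, j)) (1 : ℝ)
  have hblock : ∀ k : ℕ, ∃ v : Fin (n + 1) → ℝ, v ≠ 0 ∧ ∀ i, ∑ j, v j * φ i (e k j) = 0 := by
    intro k
    let f : (Fin (n + 1) → ℝ) →ₗ[ℝ] (Fin n → ℝ) :=
      Matrix.toLin' (Matrix.of fun i j => φ i (e k j))
    have hk : LinearMap.ker f ≠ ⊥ := LinearMap.ker_ne_bot_of_finrank_lt (by simp)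
    obtain ⟨v, hv, hv0⟩ := Submodule.exists_mem_ne_zero_of_ne_bot hk
    refine ⟨v, hv0, fun i => ?_⟩
    have := congrFun (LinearMap.mem_ker.1 hv) i
    simpa [f, Matrix.mulVec, dotProduct, mul_comm] using this
  choose v hv0 hv using hblock
  have hpos : ∀ k, 0 < ∑ j, |v k j| := by
    intro k
    obtain ⟨j, hj⟩ := Function.ne_iff.1 (hv0 k)
    exact Finset.sum_pos' (fun _ _ => abs_nonneg _) ⟨j, Finset.mem_univ j, abs_pos.2 hj⟩
  let w : ℕ → Fin (n + 1) → ℝ := fun k j => (∑ j, |v k j|)⁻¹ * v k j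
  have hw : ∀ k, ∑ j, |w k j| = 1 := by
    intro k
    simp only [w, abs_mul, ← Finset.mul_sum, abs_of_pos (inv_pos.2 (hpos k))]
    exact inv_mul_cancel₀ (hpos k).ne'
  refine ⟨(EllOne.blockEmbedding w hw).toContinuousLinearMap, 1, one_pos, fun z => ?_,
    fun i z => ?_⟩
  · rw [one_mul]
    exact ((EllOne.blockEmbedding w hw).norm_map z).ge
  · have : (φ i).comp (EllOne.blockEmbedding w hw).toContinuousLinearMap = 0 := by
      refine lp.ext_continuousLinearMap (by simp) fun k => ?_
      ext
      change φ i (EllOne.blockEmbedding w hw (lp.single 1 k (1 : ℝ))) = 0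
      rw [EllOne.blockEmbedding_single, map_sum]
      simp only [map_smul, smul_eq_mul, w, mul_assoc, ← Finset.mul_sum]
      rw [show (∑ j, v k j * φ i (lp.single 1 ((Nat.divModEquiv (n + 1)).symm (k, j)) (1 : ℝ))) = 0
        from hv k i, mul_zero]
    exact DFunLike.congr_fun this z

/-! ### ℓ₁ contains no copy of c₀ -/

theorem sum_abs_apply_single_le (ψ : StrongDual ℝ CZero) (e : ℕ → CZero)
    (he : ∀ k n, e k n = if n = k then 1 else 0) (F : Finset ℕ) : ∑ k ∈ F, |ψ (e k)| ≤ ‖ψ‖ := by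
  have h1 : ∑ k ∈ F, |ψ (e k)| = ψ (∑ k ∈ F, (SignType.sign (ψ (e k)) : ℝ) • e k) := by
    rw [map_sum]
    simp [sign_mul_self]
  have h2 : ‖∑ k ∈ F, (SignType.sign (ψ (e k)) : ℝ) • e k‖ ≤ 1 := by
    refine CZero.norm_le zero_le_one fun n => ?_
    have h3 : ∀ F : Finset ℕ, (∑ k ∈ F, (SignType.sign (ψ (e k)) : ℝ) • e k) n
        = ∑ k ∈ F, (SignType.sign (ψ (e k)) : ℝ) * e k n := by
      intro F
      induction F using Finset.induction_on with
      | empty => simp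
      | insert k F hk ih => rw [Finset.sum_insert hk, Finset.sum_insert hk, ← ih]; rfl
    rw [h3]
    simp only [he, mul_ite, mul_one, mul_zero, Finset.sum_ite_eq]
    split_ifs
    · rcases SignType.sign (ψ (e n)) with _ | _ | _ <;> simp
    · simp
  rw [h1]
  calc _ ≤ ‖ψ (∑ k ∈ F, (SignType.sign (ψ (e k)) : ℝ) • e k)‖ := le_abs_self _
    _ ≤ ‖ψ‖ * 1 := (ψ.le_opNorm _).trans (by gcongr)
    _ = ‖ψ‖ := mul_one _

/-- Up to δ/4 the mass of v sits on finitely many coordinates, where u k eventually has mass below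
δ/4. Each of the two errors costs twice its size. -/
theorem EllOne.eventually_norm_add (v : EllOne) (u : ℕ → EllOne)
    (hu : ∀ n, Tendsto (fun k => u k n) atTop (𝓝 0)) {δ : ℝ} (hδ : 0 < δ) :
    ∀ᶠ k in atTop, ‖v‖ + ‖u k‖ - δ ≤ ‖v + u k‖ := by
  have h1 : ∀ᶠ N in atTop, ‖v‖ - δ / 4 < ∑ n ∈ Finset.range N, |v n| :=
    v.hasSum_abs.tendsto_sum_nat.eventually_const_lt (by linarith)
  obtain ⟨N, hN⟩ := h1.exists
  have h2 : Tendsto (fun k => ∑ n ∈ Finset.range N, |u k n|) atTop (𝓝 0) := by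
    simpa using tendsto_finsetSum (Finset.range N) fun n _ => (hu n).abs
  filter_upwards [h2.eventually_lt_const (show 0 < δ / 4 by positivity)] with k hk
  have hv := v.hasSum_abs.summable.sum_add_tsum_nat_add N
  have hw := (u k).hasSum_abs.summable.sum_add_tsum_nat_add N
  have hs := (v + u k).hasSum_abs.summable.sum_add_tsum_nat_add N
  rw [← EllOne.norm_eq_tsum] at hv hw hs
  have h3 : ∑ n ∈ Finset.range N, |v n| - ∑ n ∈ Finset.range N, |u k n|
      ≤ ∑ n ∈ Finset.range N, |(v + u k) n| := by
    rw [← Finset.sum_sub_distrib]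
    exact Finset.sum_le_sum fun n _ => by
      rw [lp.coeFn_add, Pi.add_apply]; linarith [abs_sub_abs_le_abs_add (v n) (u k n)]
  have h4 : ∑' n, |u k (n + N)| - ∑' n, |v (n + N)| ≤ ∑' n, |(v + u k) (n + N)| := by
    have s1 := (summable_nat_add_iff N).2 (u k).hasSum_abs.summable
    have s2 := (summable_nat_add_iff N).2 v.hasSum_abs.summable
    have s3 := (summable_nat_add_iff N).2 (v + u k).hasSum_abs.summable
    rw [← s1.tsum_sub s2]
    refine (s1.sub s2).tsum_le_tsum (fun n => ?_) s3
    rw [lp.coeFn_add, Pi.add_apply, add_comm (v _)]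
    linarith [abs_sub_abs_le_abs_add (u k (n + N)) (v (n + N))]
  linarith

theorem EllOne.not_containsCopy_cZero : ¬ ContainsCopy CZero EllOne := by
  intro h
  obtain ⟨T, c, hc, hT⟩ := h.exists_le_norm
  let e : ℕ → CZero := fun k =>
    { toFun := fun n => if n = k then 1 else 0
      continuous_toFun := continuous_of_discreteTopology
      zero_at_infty' := by
        rw [cocompact_eq_cofinite]
        refine tendsto_const_nhds.congr' ?_
        filter_upwards [(Set.finite_singleton k).compl_mem_cofinite] with n hn
        exact (if_neg hn).symm }
  have he : ∀ k n, e k n = if n = k then 1 else 0 := fun _ _ => rfl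
  have hsum_apply : ∀ (F : Finset ℕ) (n : ℕ), (∑ k ∈ F, e k) n = if n ∈ F then 1 else 0 := by
    intro F n
    induction F using Finset.induction_on with
    | empty => simp
    | insert k F hk ih =>
      rw [Finset.sum_insert hk, ZeroAtInftyContinuousMap.add_apply, ih, he]
      by_cases hn : n = k
      · subst hn; simp [hk]
      · simp [hn]
  have hcoord : ∀ n, Tendsto (fun k => T (e k) n) atTop (𝓝 0) := by
    intro n
    let ψ : StrongDual ℝ CZero := (lp.evalCLM ℝ (fun _ : ℕ => ℝ) (p := 1) n).comp T
    have : Summable fun k => |ψ (e k)| := summable_of_sum_le (fun _ => abs_nonneg _)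
      (sum_abs_apply_single_le ψ e he)
    exact (tendsto_zero_iff_abs_tendsto_zero fun k => ψ (e k)).2 this.tendsto_atTop_zero
  have hle : ∀ k, c ≤ ‖T (e k)‖ := by
    intro k
    have h1 : 1 ≤ ‖e k‖ := by simpa [he] using (e k).abs_apply_le k
    exact (by nlinarith : c ≤ c * ‖e k‖).trans (hT _)
  -- The images tend to zero coordinatewise, so each new unit vector adds at least c - c/2 to the
  -- norm, while finite sums of unit vectors in c₀ keep norm at most 1.
  have key : ∀ N : ℕ, ∃ F : Finset ℕ, N * (c / 2) ≤ ‖T (∑ k ∈ F, e k)‖ := by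
    intro N
    induction N with
    | zero => exact ⟨∅, by simp⟩
    | succ N ih =>
      obtain ⟨F, hF⟩ := ih
      have h1 := EllOne.eventually_norm_add (T (∑ k ∈ F, e k)) (fun k => T (e k)) hcoord
        (half_pos hc)
      obtain ⟨k, hk, hkF⟩ := (h1.and (eventually_gt_atTop (F.sup id))).exists
      have hkF' : k ∉ F := fun h => (Finset.le_sup (f := id) h).not_gt hkF
      refine ⟨insert k F, ?_⟩
      rw [Finset.sum_insert hkF', add_comm (e k), map_add]
      push_cast
      linarith [hle k]
  obtain ⟨N, hN⟩ := exists_nat_gt (‖T‖ / (c / 2))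
  obtain ⟨F, hF⟩ := key N
  rw [div_lt_iff₀ (by positivity)] at hN
  have h1 : ‖∑ k ∈ F, e k‖ ≤ 1 := CZero.norm_le zero_le_one fun n => by
    rw [hsum_apply]; split_ifs <;> simp
  have h2 := T.le_opNorm (∑ k ∈ F, e k)
  nlinarith [norm_nonneg T]

/-! ### Intervals coded by the Cantor set and the basis vectors -/

/-- The set of indices at or after the first `true` of `q`. -/
def onset (q : ℕ → Bool) : Set ℕ := {n | ∃ i ≤ n, q i = true}

theorem onset_mono {q : ℕ → Bool} {m n : ℕ} (h : m ≤ n) (hm : m ∈ onset q) : n ∈ onset q := by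
  obtain ⟨i, hi, hq⟩ := hm
  exact ⟨i, hi.trans h, hq⟩

theorem isClopen_mem_onset (n : ℕ) : IsClopen {q : ℕ → Bool | n ∈ onset q} := by
  have : {q : ℕ → Bool | n ∈ onset q} = ⋃ i ∈ Finset.range (n + 1), (fun q => q i) ⁻¹' {true} := by
    ext q
    simp [onset]
  rw [this]
  exact Set.Finite.isClopen_biUnion (Finset.finite_toSet _) fun i _ =>
    (isClopen_discrete {true}).preimage (continuous_apply i)

/-- Three points of the Cantor set are coded into one: this is the `r`-th of them. -/
def slice (r : ℕ) (p : ℕ → Bool) : ℕ → Bool := fun i => p (3 * i + r)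

theorem continuous_slice (r : ℕ) : Continuous (slice r) :=
  continuous_pi fun i => continuous_apply (3 * i + r)

/-- The interval of natural numbers coded by a point of the Cantor set. -/
def window (p : ℕ → Bool) : Set ℕ := onset (slice 0 p) \ onset (slice 1 p)

theorem isClopen_mem_window (n : ℕ) : IsClopen {p : ℕ → Bool | n ∈ window p} :=
  ((isClopen_mem_onset n).preimage (continuous_slice 0)).diff
    ((isClopen_mem_onset n).preimage (continuous_slice 1))

open Classical in
/-- `f` on one half of the Cantor set, and the constant `1` on the other half. -/
noncomputable def adjoinOne (f : CantorC) : CantorC where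
  toFun t := if t 0 = true then 1 else f fun i => t (i + 1)
  continuous_toFun := by
    refine continuous_const.if ?_ ?_
    · intro t ht
      rw [IsClopen.frontier_eq] at ht
      · exact ht.elim
      · exact (isClopen_discrete {true}).preimage (continuous_apply 0)
    · exact f.continuous.comp (continuous_pi fun i => continuous_apply (i + 1))

open Classical in
/-- The vectors whose closed span is the space with a basis associated with `d`. -/
noncomputable def windowVector (d : ℕ → CantorC) (n : ℕ) : CantorC where
  toFun p := if n ∈ window p then adjoinOne (d n) (slice 2 p) else 0
  continuous_toFun := by
    refine Continuous.if ?_ ?_ continuous_const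
    · intro t ht
      rw [IsClopen.frontier_eq (isClopen_mem_window n)] at ht
      exact ht.elim
    · exact (adjoinOne (d n)).continuous.comp (continuous_slice 2)

theorem windowVector_apply_of_mem (d : ℕ → CantorC) {n : ℕ} {p : ℕ → Bool} (h : n ∈ window p) :
    windowVector d n p = adjoinOne (d n) (slice 2 p) := if_pos h

theorem windowVector_apply_of_notMem (d : ℕ → CantorC) {n : ℕ} {p : ℕ → Bool}
    (h : n ∉ window p) : windowVector d n p = 0 := if_neg h

/-- The closed linear span of a sequence. -/
noncomputable def closedSpan (d : ℕ → CantorC) : Submodule ℝ CantorC :=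
  (Submodule.span ℝ (range d)).topologicalClosure

theorem isClosed_closedSpan (d : ℕ → CantorC) : IsClosed (closedSpan d : Set CantorC) :=
  Submodule.isClosed_topologicalClosure _

/-- Composition with a self-map of the Cantor set. -/
noncomputable def pullback (φ : C(ℕ → Bool, ℕ → Bool)) : CantorC →L[ℝ] CantorC :=
  LinearMap.mkContinuous
    { toFun := fun f => f.comp φ
      map_add' := fun _ _ => rfl
      map_smul' := fun _ _ => rfl } 1 fun f => by
    rw [one_mul, ContinuousMap.norm_le _ (norm_nonneg _)]
    exact fun p => f.norm_coe_le_norm (φ p)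

@[simp] theorem pullback_apply (φ : C(ℕ → Bool, ℕ → Bool)) (f : CantorC) (p : ℕ → Bool) :
    pullback φ f p = f (φ p) := rfl

theorem norm_pullback_le (φ : C(ℕ → Bool, ℕ → Bool)) (f : CantorC) : ‖pullback φ f‖ ≤ ‖f‖ := by
  rw [ContinuousMap.norm_le _ (norm_nonneg _)]
  exact fun p => f.norm_coe_le_norm (φ p)

/-- The code of the interval of those elements of `window p` that are less than `n`. -/
def cut (n : ℕ) : C(ℕ → Bool, ℕ → Bool) where
  -- Bit 3n + 1 is entry n of slice 1, which ends the window before n.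
  toFun p := Function.update p (3 * n + 1) true
  continuous_toFun := continuous_id.update _ continuous_const

theorem slice_cut_of_ne {r : ℕ} (hr : r < 3) (h1 : r ≠ 1) (n : ℕ) (p : ℕ → Bool) :
    slice r (cut n p) = slice r p := by
  ext i
  exact Function.update_of_ne (by omega) _ _

theorem mem_window_cut {m n : ℕ} {p : ℕ → Bool} :
    m ∈ window (cut n p) ↔ m ∈ window p ∧ m < n := by
  have h1 : m ∈ onset (slice 1 (cut n p)) ↔ m ∈ onset (slice 1 p) ∨ n ≤ m := by
    constructor
    · rintro ⟨i, hi, h⟩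
      by_cases hn : i = n
      · exact Or.inr (hn ▸ hi)
      · refine Or.inl ⟨i, hi, ?_⟩
        rwa [slice, cut, ContinuousMap.coe_mk, Function.update_of_ne (by omega)] at h
    · rintro (⟨i, hi, h⟩ | h)
      · refine ⟨i, hi, ?_⟩
        by_cases hn : i = n
        · subst hn; exact Function.update_self _ _ _
        · rw [slice, cut, ContinuousMap.coe_mk, Function.update_of_ne (by omega)]
          exact h
      · exact ⟨n, h, Function.update_self _ _ _⟩
  rw [window, window, Set.mem_sdiff, Set.mem_sdiff, h1, slice_cut_of_ne (by norm_num) (by norm_num)]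
  push Not
  tauto

theorem pullback_cut_windowVector (d : ℕ → CantorC) (n k : ℕ) :
    pullback (cut n) (windowVector d k) = if k < n then windowVector d k else 0 := by
  ext p
  rw [pullback_apply]
  by_cases hk : k < n
  · rw [if_pos hk]
    by_cases hp : k ∈ window p
    · rw [windowVector_apply_of_mem d (mem_window_cut.2 ⟨hp, hk⟩), windowVector_apply_of_mem d hp,
        slice_cut_of_ne (by norm_num) (by norm_num)]
    · rw [windowVector_apply_of_notMem d (fun h => hp (mem_window_cut.1 h).1),
        windowVector_apply_of_notMem d hp]
  · rw [if_neg hk, windowVector_apply_of_notMem d (fun h => hk (mem_window_cut.1 h).2)]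
    rfl

/-- The point with slices `q₀`, `q₁`, `q₂`. -/
def merge (q₀ q₁ q₂ : ℕ → Bool) : ℕ → Bool := fun i =>
  if i % 3 = 0 then q₀ (i / 3) else if i % 3 = 1 then q₁ (i / 3) else q₂ (i / 3)

theorem slice_zero_merge (q₀ q₁ q₂ : ℕ → Bool) : slice 0 (merge q₀ q₁ q₂) = q₀ := by
  ext i
  simp [slice, merge]

theorem slice_one_merge (q₀ q₁ q₂ : ℕ → Bool) : slice 1 (merge q₀ q₁ q₂) = q₁ := by
  ext i
  have h1 : (3 * i + 1) % 3 = 1 := by omega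
  have h2 : (3 * i + 1) / 3 = i := by omega
  simp [slice, merge, h1, h2]

theorem slice_two_merge (q₀ q₁ q₂ : ℕ → Bool) : slice 2 (merge q₀ q₁ q₂) = q₂ := by
  ext i
  have h1 : (3 * i + 2) % 3 = 2 := by omega
  have h2 : (3 * i + 2) / 3 = i := by omega
  simp [slice, merge, h1, h2]

/-- The point with window `ℕ` and last slice `t`. -/
def full (t : ℕ → Bool) : ℕ → Bool := merge (fun _ => true) (fun _ => false) t

theorem mem_window_full (n : ℕ) (t : ℕ → Bool) : n ∈ window (full t) := by
  simp [window, full, slice_zero_merge, slice_one_merge, onset]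
  exact ⟨n, le_rfl⟩

theorem windowVector_full (d : ℕ → CantorC) (n : ℕ) (t : ℕ → Bool) :
    windowVector d n (full t) = adjoinOne (d n) t := by
  rw [windowVector_apply_of_mem d (mem_window_full n t), full, slice_two_merge]

/-- The point with `b` in front of `t`. -/
def consBool (b : Bool) (t : ℕ → Bool) : ℕ → Bool := fun i => Nat.casesOn i b t

theorem adjoinOne_true (f : CantorC) {t : ℕ → Bool} (ht : t 0 = true) : adjoinOne f t = 1 :=
  if_pos ht

theorem adjoinOne_false (f : CantorC) (t : ℕ → Bool) : adjoinOne f (consBool false t) = f t :=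
  if_neg (c := consBool false t 0 = true) (t := (1 : ℝ)) Bool.false_ne_true

/-- The embedding of the Cantor set that recovers the sequence `d` from `windowVector d`. -/
def fullFalse : C(ℕ → Bool, ℕ → Bool) where
  toFun t := full (consBool false t)
  continuous_toFun := by
    refine continuous_pi fun i => ?_
    simp only [full, merge]
    split_ifs
    · exact continuous_const
    · exact continuous_const
    · rcases i / 3 with _ | j
      · exact continuous_const
      · exact continuous_apply j

theorem pullback_fullFalse_windowVector (d : ℕ → CantorC) (n : ℕ) :
    pullback fullFalse (windowVector d n) = d n := by
  ext t
  exact (windowVector_full d n _).trans (adjoinOne_false (d n) t)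

/-- The point with window `{n}` at which `windowVector d n` is `1`. -/
def spike (n : ℕ) : ℕ → Bool :=
  merge (fun i => decide (i = n)) (fun i => decide (i = n + 1)) fun _ => true

theorem mem_window_spike {m n : ℕ} : m ∈ window (spike n) ↔ m = n := by
  simp only [window, spike, slice_zero_merge, slice_one_merge, onset, Set.mem_sdiff, mem_ofPred_eq,
    decide_eq_true_eq]
  constructor
  · rintro ⟨⟨i, hi, rfl⟩, h⟩
    by_contra hne
    exact h ⟨i + 1, by omega, rfl⟩
  · rintro rfl
    refine ⟨⟨m, le_rfl, rfl⟩, ?_⟩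
    rintro ⟨i, hi, rfl⟩
    omega

theorem windowVector_spike (d : ℕ → CantorC) (m n : ℕ) :
    windowVector d m (spike n) = if m = n then 1 else 0 := by
  split_ifs with h
  · rw [windowVector_apply_of_mem d (mem_window_spike.2 h), spike, slice_two_merge,
      adjoinOne_true _ rfl]
  · exact windowVector_apply_of_notMem d fun h' => h (mem_window_spike.1 h')

/-! ### The Schauder basis and the quotient map -/

/-- The space with a basis associated with the sequence `d`. -/
noncomputable def windowSpace (d : ℕ → CantorC) : Submodule ℝ CantorC := closedSpan (windowVector d)

theorem mem_closedSpan (d : ℕ → CantorC) (n : ℕ) : d n ∈ closedSpan d :=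
  Submodule.le_topologicalClosure _ (Submodule.subset_span (mem_range_self n))

theorem eqOn_closedSpan {d : ℕ → CantorC} {W : Type*} [NormedAddCommGroup W] [NormedSpace ℝ W]
    {S T : CantorC →L[ℝ] W} (h : ∀ n, S (d n) = T (d n)) {f : CantorC}
    (hf : f ∈ closedSpan d) : S f = T f := by
  have : closedSpan d ≤ LinearMap.ker (S - T).toLinearMap :=
    Submodule.topologicalClosure_minimal _ (Submodule.span_le.2 (range_subset_iff.2 fun n => by
      simp [h n])) (S - T).isClosed_ker
  exact sub_eq_zero.1 (LinearMap.mem_ker.1 (this hf))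

/-- Evaluation at `spike i` is the i-th coordinate functional. The partial-sum projections are
therefore composition operators, hence contractions. -/
theorem pullback_cut_eq_sum {d : ℕ → CantorC} {f : CantorC} (hf : f ∈ windowSpace d) (n : ℕ) :
    pullback (cut n) f = ∑ i ∈ Finset.range n, f (spike i) • windowVector d i := by
  have := eqOn_closedSpan (d := windowVector d) (S := pullback (cut n))
    (T := ∑ i ∈ Finset.range n, (ContinuousMap.evalCLM ℝ (spike i)).smulRight (windowVector d i))
    (fun k => by
      simp [pullback_cut_windowVector, windowVector_spike]) hf
  simpa using this

theorem tendsto_pullback_cut {d : ℕ → CantorC} {f : CantorC} (hf : f ∈ windowSpace d) :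
    Tendsto (fun n => pullback (cut n) f) atTop (𝓝 f) := by
  have hspan : ∀ g ∈ Submodule.span ℝ (range (windowVector d)),
      ∃ N, ∀ n ≥ N, pullback (cut n) g = g := by
    intro g hg
    induction hg using Submodule.span_induction with
    | mem g hg =>
      obtain ⟨k, rfl⟩ := hg
      exact ⟨k + 1, fun n hn => by rw [pullback_cut_windowVector, if_pos (by omega)]⟩
    | zero => exact ⟨0, fun n _ => map_zero _⟩
    | add g h _ _ hg hh =>
      obtain ⟨N, hN⟩ := hg
      obtain ⟨M, hM⟩ := hh
      exact ⟨max N M, fun n hn => by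
        rw [map_add, hN n (le_of_max_le_left hn), hM n (le_of_max_le_right hn)]⟩
    | smul s g _ hg =>
      obtain ⟨N, hN⟩ := hg
      exact ⟨N, fun n hn => by rw [map_smul, hN n hn]⟩
  rw [Metric.tendsto_atTop]
  intro ε hε
  obtain ⟨g, hg, hfg⟩ := Metric.mem_closure_iff.1 hf (ε / 2) (half_pos hε)
  obtain ⟨N, hN⟩ := hspan g hg
  refine ⟨N, fun n hn => ?_⟩
  calc dist (pullback (cut n) f) f
      ≤ dist (pullback (cut n) f) (pullback (cut n) g) + dist (pullback (cut n) g) f :=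
        dist_triangle _ _ _
    _ < ε / 2 + ε / 2 := by
        refine add_lt_add ?_ ?_
        · rw [dist_eq_norm, ← map_sub]
          rw [dist_eq_norm] at hfg
          exact (norm_pullback_le _ _).trans_lt hfg
        · rw [hN n hn, dist_comm]; exact hfg
    _ = ε := add_halves ε

/-- The basis is indexed by ℕ and has biorthogonal functionals, so the space is also
infinite-dimensional. -/
theorem windowSpace_schauderBasis (d : ℕ → CantorC) :
    Nonempty (SchauderBasis ℝ (windowSpace d)) :=
  ⟨{  basis := fun n => ⟨windowVector d n, mem_closedSpan _ n⟩
      coord := fun n => (ContinuousMap.evalCLM ℝ (spike n)).comp (Submodule.subtypeL _)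
      ortho := fun i j => by
        change windowVector d j (spike i) = _
        rw [windowVector_spike]
        simp [Pi.single, Function.update, eq_comm]
      expansion := fun f => by
        rw [HasSum, SummationFilter.conditional_filter_eq_map_range, tendsto_map'_iff,
          tendsto_subtype_rng]
        refine (tendsto_pullback_cut f.2).congr fun n => ?_
        rw [pullback_cut_eq_sum f.2]
        simp }⟩

theorem pullback_fullFalse_mem {d : ℕ → CantorC} {f : CantorC} (hf : f ∈ windowSpace d) :
    pullback fullFalse f ∈ closedSpan d := by
  have : windowSpace d ≤ (closedSpan d).comap (pullback fullFalse).toLinearMap := by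
    refine Submodule.topologicalClosure_minimal _ (Submodule.span_le.2 (range_subset_iff.2
      fun n => ?_)) ((isClosed_closedSpan d).preimage (pullback fullFalse).continuous)
    simp only [SetLike.mem_coe, Submodule.mem_comap, ContinuousLinearMap.coe_coe,
      pullback_fullFalse_windowVector]
    exact mem_closedSpan d n
  exact this hf

theorem norm_adjoinOne_le {f : CantorC} (hf : ‖f‖ ≤ 1) : ‖adjoinOne f‖ ≤ 1 := by
  rw [ContinuousMap.norm_le _ zero_le_one]
  intro t
  by_cases ht : t 0 = true
  · rw [adjoinOne_true f ht, norm_one]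
  · rw [show adjoinOne f t = f fun i => t (i + 1) from if_neg ht]
    exact (f.norm_coe_le_norm _).trans hf

theorem norm_windowVector_le {d : ℕ → CantorC} {n : ℕ} (hd : ‖d n‖ ≤ 1) :
    ‖windowVector d n‖ ≤ 1 := by
  rw [ContinuousMap.norm_le _ zero_le_one]
  intro p
  by_cases hp : n ∈ window p
  · rw [windowVector_apply_of_mem d hp]
    exact ((adjoinOne (d n)).norm_coe_le_norm _).trans (norm_adjoinOne_le hd)
  · rw [windowVector_apply_of_notMem d hp, norm_zero]; exact zero_le_one

/-- Successive approximation: the remainders halve at each step, and the corrections form an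
absolutely convergent series in `Y`. -/
theorem surjOn_of_norm_sub_le_half {E F : Type*} [NormedAddCommGroup E] [NormedSpace ℝ E]
    [CompleteSpace E] [NormedAddCommGroup F] [NormedSpace ℝ F] (Q : E →L[ℝ] F)
    {Y : Submodule ℝ E} (hY : IsClosed (Y : Set E)) {X : Submodule ℝ F} (hQ : ∀ y ∈ Y, Q y ∈ X)
    (h : ∀ x ∈ X, ∃ y ∈ Y, ‖y‖ ≤ ‖x‖ ∧ ‖x - Q y‖ ≤ ‖x‖ / 2) : SurjOn Q Y X := by
  choose! s hsY hs hQs using h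
  intro x hx
  let r : ℕ → F := fun n => (fun z => z - Q (s z))^[n] x
  have hr : ∀ n, r (n + 1) = r n - Q (s (r n)) := fun n => Function.iterate_succ_apply' _ _ _
  have hrX : ∀ n, r n ∈ X := by
    intro n
    induction n with
    | zero => exact hx
    | succ n ih => rw [hr]; exact X.sub_mem ih (hQ _ (hsY _ ih))
  have hnorm : ∀ n, ‖r n‖ ≤ ‖x‖ * (1 / 2) ^ n := by
    intro n
    induction n with
    | zero => simp [r]
    | succ n ih =>
      rw [hr, pow_succ]
      linarith [hQs (r n) (hrX n)]
  have hsum : Summable fun n => s (r n) :=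
    Summable.of_norm_bounded (summable_geometric_two.mul_left ‖x‖)
      fun n => (hs _ (hrX n)).trans (hnorm n)
  have h1 : ∀ n, Q (∑ i ∈ Finset.range n, s (r i)) = x - r n := by
    intro n
    induction n with
    | zero => simp [r]
    | succ n ih => rw [Finset.sum_range_succ, map_add, ih, hr]; abel
  have h2 : Tendsto r atTop (𝓝 0) := by
    refine squeeze_zero_norm hnorm ?_
    simpa using (tendsto_pow_atTop_nhds_zero_of_lt_one (r := (1 / 2 : ℝ)) (by norm_num)
      (by norm_num)).const_mul ‖x‖
  refine ⟨∑' n, s (r n), hY.mem_of_tendsto hsum.hasSum.tendsto_sum_nat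
    (Eventually.of_forall fun n => Y.sum_mem fun i _ => hsY _ (hrX i)), ?_⟩
  refine tendsto_nhds_unique ((Q.continuous.tendsto _).comp hsum.hasSum.tendsto_sum_nat) ?_
  simp only [Function.comp_def, h1]
  simpa using h2.const_sub x

theorem surjOn_pullback_fullFalse {d : ℕ → CantorC} (hd : ∀ n, ‖d n‖ ≤ 1)
    (hdense : ∀ x ∈ closedSpan d, ‖x‖ ≤ 1 → ∀ ε > 0, ∃ n, ‖x - d n‖ < ε) :
    SurjOn (pullback fullFalse) (windowSpace d) (closedSpan d) := by
  refine surjOn_of_norm_sub_le_half _ (isClosed_closedSpan _)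
    (fun y hy => pullback_fullFalse_mem hy) fun x hxX => ?_
  by_cases hx : x = 0
  · exact ⟨0, zero_mem _, by simp [hx]⟩
  have hpos : 0 < ‖x‖ := norm_pos_iff.2 hx
  obtain ⟨n, hn⟩ := hdense (‖x‖⁻¹ • x) (Submodule.smul_mem _ _ hxX) (by
    rw [norm_smul, norm_inv, norm_norm]
    exact (inv_mul_cancel₀ hpos.ne').le) (1 / 2) (by norm_num)
  refine ⟨‖x‖ • windowVector d n, Submodule.smul_mem _ _ (mem_closedSpan _ n), ?_, ?_⟩
  · rw [norm_smul, norm_norm]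
    exact mul_le_of_le_one_right hpos.le (norm_windowVector_le (hd n))
  · rw [map_smul, pullback_fullFalse_windowVector]
    have : x - ‖x‖ • d n = ‖x‖ • (‖x‖⁻¹ • x - d n) := by
      rw [smul_sub, smul_smul, mul_inv_cancel₀ hpos.ne', one_smul]
    rw [this, norm_smul, norm_norm]
    nlinarith

theorem isQuotientOf_windowSpace {d : ℕ → CantorC} (hd : ∀ n, ‖d n‖ ≤ 1)
    (hdense : ∀ x ∈ closedSpan d, ‖x‖ ≤ 1 → ∀ ε > 0, ∃ n, ‖x - d n‖ < ε) :
    IsQuotientOf (closedSpan d) (windowSpace d) := by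
  refine ⟨((pullback fullFalse).comp (Submodule.subtypeL _)).codRestrict _ fun f =>
    pullback_fullFalse_mem f.2, fun x => ?_⟩
  obtain ⟨y, hy, hyx⟩ := surjOn_pullback_fullFalse hd hdense x.2
  exact ⟨⟨y, hy⟩, Subtype.ext hyx⟩

/-! ### The gliding hump -/

theorem pullback_cut_eq_of_window {d : ℕ → CantorC} {f : CantorC} (hf : f ∈ windowSpace d)
    {m n : ℕ} (hm : ∀ i < m, f (spike i) = 0) {p q : ℕ → Bool} (hs : slice 2 p = slice 2 q)
    (h : ∀ j, m ≤ j → j < n → (j ∈ window p ↔ j ∈ window q)) :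
    pullback (cut n) f p = pullback (cut n) f q := by
  rw [pullback_cut_eq_sum hf, ContinuousMap.sum_apply, ContinuousMap.sum_apply]
  refine Finset.sum_congr rfl fun i hi => ?_
  rw [ContinuousMap.smul_apply, ContinuousMap.smul_apply]
  rcases lt_or_ge i m with him | him
  · rw [hm i him, zero_smul, zero_smul]
  · have hw := h i him (Finset.mem_range.1 hi)
    by_cases hp : i ∈ window p
    · rw [windowVector_apply_of_mem d hp, windowVector_apply_of_mem d (hw.1 hp), hs]
    · rw [windowVector_apply_of_notMem d hp, windowVector_apply_of_notMem d fun h' => hp (hw.2 h')]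

theorem pullback_cut_eq_zero {d : ℕ → CantorC} {f : CantorC} (hf : f ∈ windowSpace d)
    {m n : ℕ} (hm : ∀ i < m, f (spike i) = 0) {p : ℕ → Bool}
    (h : ∀ j, m ≤ j → j < n → j ∉ window p) : pullback (cut n) f p = 0 := by
  rw [pullback_cut_eq_sum hf, ContinuousMap.sum_apply]
  refine Finset.sum_eq_zero fun i hi => ?_
  rw [ContinuousMap.smul_apply]
  rcases lt_or_ge i m with him | him
  · rw [hm i him, zero_smul]
  · rw [windowVector_apply_of_notMem d (h i him (Finset.mem_range.1 hi)), smul_zero]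

/-- At these points every basis vector equals 1, so evaluation there is a single functional, the sum
of the coefficients; one linear condition makes it vanish. -/
theorem apply_full_of_true {d : ℕ → CantorC} {f : CantorC} (hf : f ∈ windowSpace d)
    {t : ℕ → Bool} (ht : t 0 = true) : f (full t) = f (full fun _ => true) :=
  eqOn_closedSpan (S := ContinuousMap.evalCLM ℝ (full t))
    (T := ContinuousMap.evalCLM ℝ (full fun _ => true)) (fun n => by
      change windowVector d n _ = windowVector d n _
      rw [windowVector_full, windowVector_full, adjoinOne_true _ ht, adjoinOne_true _ rfl]) hf

theorem abs_apply_full_le {d : ℕ → CantorC} {f : CantorC} (hf : f ∈ windowSpace d)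
    (h1 : f (full fun _ => true) = 0) (t : ℕ → Bool) :
    |f (full t)| ≤ ‖pullback fullFalse f‖ := by
  cases ht : t 0
  · have h2 : full t = fullFalse fun i => t (i + 1) := by
      change full t = full _
      congr 1
      ext (_ | i)
      · exact ht
      · rfl
    rw [h2]
    exact (pullback fullFalse f).norm_coe_le_norm _
  · rw [apply_full_of_true hf ht, h1, abs_zero]
    exact norm_nonneg _

/-- The set `U` separates two points of the interval `[m, n)`. -/
def Splits (U : Set ℕ) (m n : ℕ) : Prop :=
  (∃ j, m ≤ j ∧ j < n ∧ j ∈ U) ∧ ∃ j, m ≤ j ∧ j < n ∧ j ∉ U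

open Classical in
-- An upward closed set has a single threshold, which is interior to at most one of the consecutive
-- intervals.
theorem sum_splits_le_one {U : Set ℕ} (hU : ∀ i j, i ≤ j → i ∈ U → j ∈ U) {N : ℕ → ℕ}
    (hN : Monotone N) (F : Finset ℕ) :
    ∑ k ∈ F, (if Splits U (N k) (N (k + 1)) then 1 else 0 : ℝ) ≤ 1 := by
  have key : ∀ k l, k < l → Splits U (N k) (N (k + 1)) → ¬ Splits U (N l) (N (l + 1)) := by
    rintro k l hkl ⟨⟨i, _, hi, hiU⟩, -⟩ ⟨-, ⟨j, hj, _, hjU⟩⟩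
    exact hjU (hU i j (hi.le.trans ((hN (Nat.succ_le_of_lt hkl)).trans hj)) hiU)
  rw [Finset.sum_boole]
  norm_cast
  refine Finset.card_le_one.2 fun k hk l hl => ?_
  simp only [Finset.mem_filter] at hk hl
  rcases lt_trichotomy k l with h | h | h
  · exact (key k l h hk.2 hl.2).elim
  · exact h
  · exact (key l k h hl.2 hk.2).elim

open Classical in
-- If no endpoint of the window cuts [m, n), the window misses [m, n) or contains it. In the first
-- case f is within δ of 0; in the second, it is within 2δ of its value at a full window, which Q
-- controls up to δ.
theorem abs_apply_le_splits {d : ℕ → CantorC} {f : CantorC} (hf : f ∈ windowSpace d)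
    {m n : ℕ} {δ : ℝ} (hm : ∀ i < m, f (spike i) = 0) (h1 : f (full fun _ => true) = 0)
    (hf1 : ‖f‖ ≤ 1) (hR : ‖pullback fullFalse f‖ ≤ δ) (hn : ‖f - pullback (cut n) f‖ ≤ δ)
    (p : ℕ → Bool) :
    |f p| ≤ (if Splits (onset (slice 0 p)) m n then 1 else 0) +
      (if Splits (onset (slice 1 p)) m n then 1 else 0) + 3 * δ := by
  have hδ : 0 ≤ δ := (norm_nonneg _).trans hR
  have hclose : ∀ q, |f q - pullback (cut n) f q| ≤ δ := fun q =>
    ((f - pullback (cut n) f).norm_coe_le_norm q).trans hn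
  have hle1 : |f p| ≤ 1 := (f.norm_coe_le_norm p).trans hf1
  by_cases hs0 : Splits (onset (slice 0 p)) m n
  · rw [if_pos hs0]
    split_ifs
    all_goals linarith
  by_cases hs1 : Splits (onset (slice 1 p)) m n
  · rw [if_pos hs1]
    split_ifs
    all_goals linarith
  rw [if_neg hs0, if_neg hs1]
  have hcase : (∀ j, m ≤ j → j < n → j ∉ window p) ∨ ∀ j, m ≤ j → j < n → j ∈ window p := by
    by_contra! hcon
    obtain ⟨⟨i, hmi, hin, hi⟩, ⟨j, hmj, hjn, hj⟩⟩ := hcon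
    by_cases hj0 : j ∈ onset (slice 0 p)
    · exact hs1 ⟨⟨j, hmj, hjn, by_contra fun h => hj ⟨hj0, h⟩⟩, ⟨i, hmi, hin, hi.2⟩⟩
    · exact hs0 ⟨⟨i, hmi, hin, hi.1⟩, ⟨j, hmj, hjn, hj0⟩⟩
  rcases hcase with h | h
  · have := hclose p
    rw [pullback_cut_eq_zero hf hm h, sub_zero] at this
    linarith
  · have e : pullback (cut n) f p = pullback (cut n) f (full (slice 2 p)) :=
      pullback_cut_eq_of_window hf hm (slice_two_merge _ _ _).symm
        fun j hj hjn => iff_of_true (h j hj hjn) (mem_window_full j _)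
    have h2 := hclose p
    have h3 := hclose (full (slice 2 p))
    have h4 := abs_apply_full_le hf h1 (slice 2 p)
    rw [e] at h2
    rw [abs_le] at *
    constructor <;> linarith

theorem exists_small_vector {Z : Type*} [NormedAddCommGroup Z] [NormedSpace ℝ Z]
    {d : ℕ → CantorC} (T : Z →L[ℝ] CantorC) (hTd : ∀ z, T z ∈ windowSpace d) {c : ℝ} (hc : 0 < c)
    (hT : ∀ z, c * ‖z‖ ≤ ‖T z‖)
    (h : ∀ (n : ℕ) (ε : ℝ), 0 < ε → ∃ z, (∀ i < n, T z (spike i) = 0) ∧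
      T z (full fun _ => true) = 0 ∧ ‖pullback fullFalse (T z)‖ < ε * ‖z‖)
    (n : ℕ) {δ : ℝ} (hδ : 0 < δ) :
    ∃ z, (∀ i < n, T z (spike i) = 0) ∧ T z (full fun _ => true) = 0 ∧ ‖T z‖ = 1 ∧
      ‖pullback fullFalse (T z)‖ ≤ δ ∧
      ∃ n' ≥ n, ∀ m ≥ n', ‖T z - pullback (cut m) (T z)‖ ≤ δ := by
  -- The factor c turns smallness relative to ‖z‖ into smallness relative to ‖T z‖; strictness
  -- excludes z = 0.
  obtain ⟨z, hz, hz1, hzR⟩ := h n (c * δ) (by positivity)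
  have hpos : 0 < ‖T z‖ := by
    have hz0 : 0 < ‖z‖ := by
      by_contra h0
      have := norm_nonneg (pullback fullFalse (T z))
      have h00 : ‖z‖ = 0 := le_antisymm (not_lt.1 h0) (norm_nonneg _)
      rw [h00, mul_zero] at hzR
      linarith
    exact (mul_pos hc hz0).trans_le (hT z)
  refine ⟨‖T z‖⁻¹ • z, fun i hi => ?_, ?_, ?_, ?_, ?_⟩
  · rw [map_smul, ContinuousMap.smul_apply, hz i hi, smul_zero]
  · rw [map_smul, ContinuousMap.smul_apply, hz1, smul_zero]
  · rw [map_smul, norm_smul, norm_inv, norm_norm, inv_mul_cancel₀ hpos.ne']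
  · rw [map_smul, map_smul, norm_smul, norm_inv, norm_norm, inv_mul_le_iff₀ hpos]
    nlinarith [hT z]
  · have h1 := tendsto_pullback_cut (hTd (‖T z‖⁻¹ • z))
    obtain ⟨n', hn'⟩ := Metric.tendsto_atTop.1 h1 δ hδ
    refine ⟨max n n', le_max_left _ _, fun m hm => ?_⟩
    rw [← dist_eq_norm, dist_comm]
    exact (hn' m (le_of_max_le_right hm)).le

/-- Otherwise a gliding hump through the copy of `Z` produces the basis of c₀. -/
theorem exists_lower_bound {Z : Type*} [NormedAddCommGroup Z] [NormedSpace ℝ Z] [CompleteSpace Z]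
    {d : ℕ → CantorC} (T : Z →L[ℝ] CantorC) (hTd : ∀ z, T z ∈ windowSpace d) {c : ℝ} (hc : 0 < c)
    (hT : ∀ z, c * ‖z‖ ≤ ‖T z‖) (hZ : ¬ ContainsCopy CZero Z) :
    ∃ (n : ℕ) (ε : ℝ), 0 < ε ∧ ∀ z, (∀ i < n, T z (spike i) = 0) →
      T z (full fun _ => true) = 0 → ε * ‖z‖ ≤ ‖pullback fullFalse (T z)‖ := by
  classical
  by_contra! hcon
  let δ : ℕ → ℝ := fun k => (1 / 2) ^ k / 16
  have hδ : ∀ k, 0 < δ k := fun k => by positivity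
  have hδsum : ∀ F : Finset ℕ, ∑ k ∈ F, δ k ≤ 1 / 8 := by
    intro F
    have h1 : Summable δ := summable_geometric_two.div_const 16
    refine (h1.sum_le_tsum F fun k _ => (hδ k).le).trans ?_
    rw [tsum_div_const, tsum_geometric_two]
    norm_num
  choose z' hz0' hz1' hzn' hzR' n' hn' hcut' using fun k n =>
    exists_small_vector T hTd hc hT hcon n (hδ k)
  let N : ℕ → ℕ := fun k => Nat.rec 0 (fun k n => n' k n) k
  have hN : Monotone N := monotone_nat_of_le_succ fun k => hn' k (N k)
  let z : ℕ → Z := fun k => z' k (N k)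
  let y : ℕ → CantorC := fun k => T (z k)
  have hyd : ∀ k, y k ∈ windowSpace d := fun k => hTd _
  have hy0 : ∀ k, ∀ i < N k, y k (spike i) = 0 := fun k => hz0' k (N k)
  have hy1 : ∀ k, ‖y k‖ = 1 := fun k => hzn' k (N k)
  have hcut : ∀ k, ∀ m ≥ N (k + 1), ‖y k - pullback (cut m) (y k)‖ ≤ δ k :=
    fun k => hcut' k (N k)
  have hcut0 : ∀ k, ∀ m ≤ N k, pullback (cut m) (y k) = 0 := by
    intro k m hm
    rw [pullback_cut_eq_sum (hyd k)]
    exact Finset.sum_eq_zero fun i hi => by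
      rw [hy0 k i ((Finset.mem_range.1 hi).trans_le hm), zero_smul]
  have hTsum : ∀ (F : Finset ℕ) (a : ℕ → ℝ), T (∑ k ∈ F, a k • z k) = ∑ k ∈ F, a k • y k :=
    fun F a => by simp [y]
  have hupper : ∀ (F : Finset ℕ) (a : ℕ → ℝ) (r : ℝ), 0 ≤ r → (∀ k ∈ F, |a k| ≤ r) →
      ‖∑ k ∈ F, a k • y k‖ ≤ 3 * r := by
    intro F a r hr ha
    rw [ContinuousMap.norm_le _ (by positivity)]
    intro p
    -- Each endpoint of the window contributes at most 1, and the errors at most 3/8.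
    have h1 : ∑ k ∈ F, |y k p| ≤ 3 := by
      have h2 := Finset.sum_le_sum fun k (_ : k ∈ F) =>
        abs_apply_le_splits (hyd k) (hy0 k) (hz1' k (N k)) (hy1 k).le (hzR' k (N k))
          (hcut k _ le_rfl) p
      rw [Finset.sum_add_distrib, Finset.sum_add_distrib, ← Finset.mul_sum] at h2
      have h3 := sum_splits_le_one (U := onset (slice 0 p)) (fun i j => onset_mono) hN F
      have h4 := sum_splits_le_one (U := onset (slice 1 p)) (fun i j => onset_mono) hN F
      linarith [hδsum F]
    rw [ContinuousMap.sum_apply, Real.norm_eq_abs]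
    calc |∑ k ∈ F, (a k • y k) p| ≤ ∑ k ∈ F, |(a k • y k) p| := Finset.abs_sum_le_sum_abs _ _
      _ ≤ ∑ k ∈ F, r * |y k p| := Finset.sum_le_sum fun k hk => by
          rw [ContinuousMap.smul_apply, smul_eq_mul, abs_mul]
          exact mul_le_mul_of_nonneg_right (ha k hk) (abs_nonneg _)
      _ ≤ 3 * r := by rw [← Finset.mul_sum]; nlinarith
  have hlower : ∀ (F : Finset ℕ) (a : ℕ → ℝ) (k : ℕ), k ∈ F →
      1 / 4 * |a k| ≤ ‖∑ k ∈ F, a k • y k‖ := by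
    intro F a k hk
    obtain ⟨l, hl, hmax⟩ := F.exists_max_image (fun k => |a k|) ⟨k, hk⟩
    refine (mul_le_mul_of_nonneg_left (hmax k hk) (by norm_num)).trans ?_
    -- The projection onto block l, of norm at most 2. With |a l| maximal, its value has norm at
    -- least (7/8 - 1/4)|a l|, and half of this exceeds |a l|/4.
    let B : CantorC →L[ℝ] CantorC := pullback (cut (N (l + 1))) - pullback (cut (N l))
    have hB : ∀ f, ‖B f‖ ≤ 2 * ‖f‖ := fun f => by
      have := norm_sub_le (pullback (cut (N (l + 1))) f) (pullback (cut (N l)) f)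
      have h1 := norm_pullback_le (cut (N (l + 1))) f
      have h2 := norm_pullback_le (cut (N l)) f
      change ‖pullback (cut (N (l + 1))) f - pullback (cut (N l)) f‖ ≤ _
      linarith
    have hBl : 1 - δ l ≤ ‖B (y l)‖ := by
      change _ ≤ ‖pullback (cut (N (l + 1))) (y l) - pullback (cut (N l)) (y l)‖
      rw [hcut0 l _ le_rfl, sub_zero]
      have h1 := hcut l _ le_rfl
      have h2 := norm_sub_norm_le (y l) (pullback (cut (N (l + 1))) (y l))
      rw [hy1] at h2
      linarith
    have hBk : ∀ k, k ≠ l → ‖B (y k)‖ ≤ 2 * δ k := by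
      intro k hkl
      change ‖pullback (cut (N (l + 1))) (y k) - pullback (cut (N l)) (y k)‖ ≤ _
      rcases lt_or_gt_of_ne hkl with h | h
      · have h1 := hcut k (N (l + 1)) (hN (show k + 1 ≤ l + 1 by omega))
        have h2 := hcut k (N l) (hN (show k + 1 ≤ l by omega))
        rw [norm_sub_rev] at h1
        have := norm_sub_le_norm_sub_add_norm_sub (pullback (cut (N (l + 1))) (y k)) (y k)
          (pullback (cut (N l)) (y k))
        linarith
      · rw [hcut0 k _ (hN (show l + 1 ≤ k by omega)), hcut0 k _ (hN h.le), sub_zero, norm_zero]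
        linarith [hδ k]
    have hsplit : B (∑ k ∈ F, a k • y k) = a l • B (y l) + ∑ k ∈ F.erase l, a k • B (y k) := by
      rw [← Finset.add_sum_erase F _ hl]
      simp
    have hrest : ‖∑ k ∈ F.erase l, a k • B (y k)‖ ≤ |a l| * (1 / 4) := by
      calc _ ≤ ∑ k ∈ F.erase l, ‖a k • B (y k)‖ := norm_sum_le _ _
        _ ≤ ∑ k ∈ F.erase l, |a l| * (2 * δ k) := Finset.sum_le_sum fun k hk => by
            rw [norm_smul, Real.norm_eq_abs]
            exact mul_le_mul (hmax k (Finset.mem_of_mem_erase hk))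
              (hBk k (Finset.ne_of_mem_erase hk)) (norm_nonneg _) (abs_nonneg _)
        _ ≤ |a l| * (1 / 4) := by
            rw [← Finset.mul_sum, ← Finset.mul_sum]
            exact mul_le_mul_of_nonneg_left (by linarith [hδsum (F.erase l)]) (abs_nonneg _)
    have h1 := hB (∑ k ∈ F, a k • y k)
    rw [hsplit] at h1
    have h2 := norm_sub_le_norm_add (a l • B (y l)) (∑ k ∈ F.erase l, a k • B (y k))
    rw [norm_smul, Real.norm_eq_abs] at h2
    have h3 : δ l ≤ 1 / 8 := by simpa using hδsum {l}
    nlinarith [abs_nonneg (a l)]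
  refine hZ (containsCopy_cZero z (c := (1 / 4) / (‖T‖ + 1)) (M := 3 / c) (by positivity)
    (by positivity) ?_ ?_)
  · intro F a r hr ha
    have h1 := hT (∑ k ∈ F, a k • z k)
    rw [hTsum] at h1
    rw [div_mul_eq_mul_div, le_div_iff₀ hc, mul_comm]
    exact h1.trans (hupper F a r hr ha)
  · intro F a k hk
    have h1 := T.le_opNorm (∑ k ∈ F, a k • z k)
    rw [hTsum] at h1
    rw [div_mul_eq_mul_div, div_le_iff₀ (by positivity)]
    nlinarith [hlower F a k hk, norm_nonneg (∑ k ∈ F, a k • z k)]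

theorem ContainsCopy.of_windowSpace {Z : Type*} [NormedAddCommGroup Z] [NormedSpace ℝ Z]
    [CompleteSpace Z] (hZ : EmbedsInFiniteCodim Z) (h0 : ¬ ContainsCopy CZero Z)
    {d : ℕ → CantorC} (h : ContainsCopy Z (windowSpace d)) : ContainsCopy Z (closedSpan d) := by
  obtain ⟨T', c, hc, hT'⟩ := h.exists_le_norm
  let T : Z →L[ℝ] CantorC := (Submodule.subtypeL _).comp T'
  have hTd : ∀ z, T z ∈ windowSpace d := fun z => (T' z).2
  have hT : ∀ z, c * ‖z‖ ≤ ‖T z‖ := hT'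
  obtain ⟨n, ε, hε, hlow⟩ := exists_lower_bound T hTd hc hT h0
  -- The n + 1 conditions are the first n coordinates and the sum of the coefficients.
  obtain ⟨S, b, hb, hS, hSφ⟩ := hZ (n + 1) (Fin.lastCases
    ((ContinuousMap.evalCLM ℝ (full fun _ => true)).comp T)
    fun i => (ContinuousMap.evalCLM ℝ (spike i)).comp T)
  have hlast : ∀ z, T (S z) (full fun _ => true) = 0 := fun z => by
    simpa using hSφ (Fin.last n) z
  have hcoord : ∀ z, ∀ i < n, T (S z) (spike i) = 0 := fun z i hi => by
    have := hSφ (Fin.castSucc ⟨i, hi⟩) z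
    rwa [Fin.lastCases_castSucc] at this
  let R : Z →L[ℝ] closedSpan d := ((pullback fullFalse).comp (T.comp S)).codRestrict _ fun z =>
    pullback_fullFalse_mem (hTd (S z))
  refine containsCopy_of_le_norm R (c := ε * b) (by positivity) fun z => ?_
  calc ε * b * ‖z‖ = ε * (b * ‖z‖) := mul_assoc _ _ _
    _ ≤ ε * ‖S z‖ := mul_le_mul_of_nonneg_left (hS z) hε.le
    _ ≤ ‖R z‖ := hlow (S z) (hcoord z) (hlast z)

/-! ### Borel structure and analyticity -/

/-- The closed linear span of a sequence, as a point of `SB`. -/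
noncomputable def SB.closedSpan (d : ℕ → CantorC) : SB :=
  ⟨_root_.closedSpan d, isClosed_closedSpan d⟩

theorem closedSpan_inter_nonempty_iff (d : ℕ → CantorC) {U : Set CantorC} (hU : IsOpen U) :
    ((closedSpan d : Set CantorC) ∩ U).Nonempty ↔
      ∃ c : ℕ →₀ ℝ, (c.sum fun n s => s • d n) ∈ U := by
  constructor
  · rintro ⟨x, hx, hxU⟩
    obtain ⟨y, hyU, hy⟩ := mem_closure_iff.1 hx U hU hxU
    obtain ⟨c, rfl⟩ := Finsupp.mem_span_range_iff_exists_finsupp.1 hy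
    exact ⟨c, hyU⟩
  · rintro ⟨c, hc⟩
    exact ⟨_, Submodule.le_topologicalClosure _
      (Finsupp.mem_span_range_iff_exists_finsupp.2 ⟨c, rfl⟩), hc⟩

/-- The span meets `U` as soon as one finite combination lies in `U`, and each combination depends
continuously on `d`. -/
theorem isOpen_closedSpan_inter_nonempty {U : Set CantorC} (hU : IsOpen U) :
    IsOpen {d : ℕ → CantorC | ((closedSpan d : Set CantorC) ∩ U).Nonempty} := by
  have : {d : ℕ → CantorC | ((closedSpan d : Set CantorC) ∩ U).Nonempty} =
      ⋃ c : ℕ →₀ ℝ, (fun d : ℕ → CantorC => c.sum fun n s => s • d n) ⁻¹' U := by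
    ext d
    rw [mem_iUnion]
    exact closedSpan_inter_nonempty_iff d hU
  rw [this]
  refine isOpen_iUnion fun c => hU.preimage ?_
  exact continuous_finsetSum _ fun n _ => (continuous_apply n).const_smul (c n)

theorem SB.measurable_of_isOpen {E : Type*} [TopologicalSpace E] [MeasurableSpace E]
    [OpensMeasurableSpace E] {g : E → SB}
    (hg : ∀ U : Set CantorC, IsOpen U → IsOpen {e | (((g e).1 : Set CantorC) ∩ U).Nonempty}) :
    Measurable g := by
  refine measurable_generateFrom ?_
  rintro _ ⟨U, hU, rfl⟩
  exact (hg U hU).measurableSet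

theorem SB.measurableSet_inter_nonempty {U : Set CantorC} (hU : IsOpen U) :
    MeasurableSet {X : SB | ((X.1 : Set CantorC) ∩ U).Nonempty} :=
  MeasurableSpace.measurableSet_generateFrom ⟨U, hU, rfl⟩

theorem SB.ext_of_inter {X Y : SB}
    (h : ∀ U ∈ TopologicalSpace.countableBasis CantorC,
      ((X.1 : Set CantorC) ∩ U).Nonempty ↔ ((Y.1 : Set CantorC) ∩ U).Nonempty) : X = Y := by
  have key : ∀ Z : SB, ∀ x, x ∈ Z.1 ↔ ∀ U ∈ TopologicalSpace.countableBasis CantorC, x ∈ U →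
      ((Z.1 : Set CantorC) ∩ U).Nonempty := by
    intro Z x
    have h1 := (TopologicalSpace.isBasis_countableBasis CantorC).mem_closure_iff
      (s := (Z.1 : Set CantorC)) (a := x)
    rw [Z.2.closure_eq] at h1
    simpa only [inter_comm, SetLike.mem_coe] using h1
  refine Subtype.ext (SetLike.ext fun x => ?_)
  rw [key X, key Y]
  exact forall₃_congr fun U hU _ => h U hU

/-- A closed subspace is determined by the basic open sets that it meets, so equality is a countable
conjunction of Borel conditions. -/
theorem SB.measurableSet_eq {E : Type*} [MeasurableSpace E] {f g : E → SB} (hf : Measurable f)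
    (hg : Measurable g) : MeasurableSet {e | f e = g e} := by
  have : {e | f e = g e} = ⋂ U ∈ TopologicalSpace.countableBasis CantorC,
      {e | (((f e).1 : Set CantorC) ∩ U).Nonempty ↔ (((g e).1 : Set CantorC) ∩ U).Nonempty} := by
    ext e
    simp only [mem_iInter]
    refine ⟨fun h U _ => ?_, fun h => SB.ext_of_inter h⟩
    have h' : f e = g e := h
    change (((f e).1 : Set CantorC) ∩ U).Nonempty ↔ (((g e).1 : Set CantorC) ∩ U).Nonempty
    rw [h']
  rw [this]
  refine MeasurableSet.biInter (TopologicalSpace.countable_countableBasis _) fun U hU => ?_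
  have hU' := TopologicalSpace.isOpen_of_mem_countableBasis hU
  exact (hf (SB.measurableSet_inter_nonempty hU')).iff (hg (SB.measurableSet_inter_nonempty hU'))

theorem continuous_windowVector : Continuous windowVector := by
  refine continuous_pi fun n => ContinuousMap.continuous_of_continuous_uncurry _ ?_
  classical
  change Continuous fun e : (ℕ → CantorC) × (ℕ → Bool) => if n ∈ window e.2 then
    (if slice 2 e.2 0 = true then (1 : ℝ) else e.1 n fun i => slice 2 e.2 (i + 1)) else 0
  have hslice : Continuous fun e : (ℕ → CantorC) × (ℕ → Bool) => slice 2 e.2 :=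
    (continuous_slice 2).comp continuous_snd
  refine Continuous.if ?_ (Continuous.if ?_ continuous_const ?_) continuous_const
  · intro e he
    exact ((((isClopen_mem_window n).preimage continuous_snd).frontier_eq).subset he).elim
  · intro e he
    exact ((((isClopen_discrete {true}).preimage
      ((continuous_apply 0).comp hslice)).frontier_eq).subset he).elim
  · exact ((continuous_apply n).comp continuous_fst).eval
      (continuous_pi fun i => (continuous_apply (i + 1)).comp hslice)

theorem exists_dense_closedSpan (X : SB) : ∃ d : ℕ → CantorC, SB.closedSpan d = X ∧
    (∀ n, ‖d n‖ ≤ 1) ∧ ∀ x ∈ X.1, ‖x‖ ≤ 1 → ∀ ε > 0, ∃ n, ‖x - d n‖ < ε := by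
  let S : Set CantorC := {x | x ∈ X.1 ∧ ‖x‖ ≤ 1}
  have : Nonempty S := ⟨⟨0, zero_mem _, by simp⟩⟩
  obtain ⟨s, hs⟩ := TopologicalSpace.exists_dense_seq S
  have hdense : ∀ x ∈ X.1, ‖x‖ ≤ 1 → ∀ ε > 0, ∃ n, ‖x - (s n).1‖ < ε := by
    intro x hx hx1 ε hε
    obtain ⟨n, hn⟩ := hs.exists_dist_lt ⟨x, hx, hx1⟩ hε
    exact ⟨n, by rw [← dist_eq_norm]; exact hn⟩
  refine ⟨fun n => (s n).1, ?_, fun n => (s n).2.2, hdense⟩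
  refine Subtype.ext (le_antisymm (Submodule.topologicalClosure_minimal _
    (Submodule.span_le.2 (range_subset_iff.2 fun n => (s n).2.1)) X.2) fun x hx => ?_)
  change x ∈ closedSpan fun n => (s n).1
  have hball : ∀ y ∈ X.1, ‖y‖ ≤ 1 → y ∈ closedSpan fun n => (s n).1 := by
    intro y hy hy1
    refine closure_mono Submodule.subset_span (Metric.mem_closure_range_iff.2 fun ε hε => ?_)
    obtain ⟨n, hn⟩ := hdense y hy hy1 ε hε
    exact ⟨n, by rwa [dist_eq_norm]⟩
  by_cases hx0 : x = 0
  · rw [hx0]; exact zero_mem _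
  have hpos : 0 < ‖x‖ := norm_pos_iff.2 hx0
  have h1 := hball (‖x‖⁻¹ • x) (X.1.smul_mem _ hx) (by
    rw [norm_smul, norm_inv, norm_norm]
    exact (inv_mul_cancel₀ hpos.ne').le)
  have h2 := Submodule.smul_mem _ ‖x‖ h1
  rwa [smul_smul, mul_inv_cancel₀ hpos.ne', one_smul] at h2

/-- The pairs (σ, d) for which `d` spans the space `f σ` form a Borel set in a Polish space. It is
thus empty or a continuous image of ℕ^ℕ, and `d` ↦ `windowSpace d` is Borel along that image. -/
theorem isAnalyticSubset_image_windowSpace {𝒜 : Set SB} (h𝒜 : IsAnalyticSubset 𝒜) :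
    IsAnalyticSubset {Y | ∃ d, SB.closedSpan d ∈ 𝒜 ∧ Y = SB.closedSpan (windowVector d)} := by
  rcases h𝒜 with rfl | ⟨f, hf, rfl⟩
  · left
    ext Y
    simp
  have : PolishSpace CantorC :=
    { toSecondCountableTopology := inferInstance
      toIsCompletelyMetrizableSpace := inferInstance }
  let : MeasurableSpace ((ℕ → ℕ) × (ℕ → CantorC)) := borel _
  have : BorelSpace ((ℕ → ℕ) × (ℕ → CantorC)) := ⟨rfl⟩
  have hfst : Measurable fun e : (ℕ → ℕ) × (ℕ → CantorC) => f e.1 :=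
    hf.comp continuous_fst.measurable
  have hsnd : Measurable fun e : (ℕ → ℕ) × (ℕ → CantorC) => SB.closedSpan e.2 :=
    SB.measurable_of_isOpen fun U hU => (isOpen_closedSpan_inter_nonempty hU).preimage continuous_snd
  have hD := (SB.measurableSet_eq hfst hsnd).analyticSet
  rw [MeasureTheory.AnalyticSet] at hD
  rcases hD with hD | ⟨h, hh, hD⟩
  · left
    refine eq_empty_of_forall_notMem ?_
    rintro _ ⟨d, ⟨σ, hσ⟩, rfl⟩
    exact notMem_empty (σ, d) (hD.subset hσ)
  · right
    refine ⟨fun σ => SB.closedSpan (windowVector (h σ).2), SB.measurable_of_isOpen fun U hU =>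
      (isOpen_closedSpan_inter_nonempty hU).preimage
        (continuous_windowVector.comp (continuous_snd.comp hh)), ?_⟩
    ext Y
    constructor
    · rintro ⟨σ, rfl⟩
      have : f (h σ).1 = SB.closedSpan (h σ).2 := hD.subset (mem_range_self σ)
      exact ⟨(h σ).2, ⟨(h σ).1, this⟩, rfl⟩
    · rintro ⟨d, ⟨σ, hσ⟩, rfl⟩
      obtain ⟨τ, hτ⟩ : (σ, d) ∈ range h := hD.superset hσ
      exact ⟨τ, by simp only [hτ]⟩

theorem corollary26 (Z : Type*) [NormedAddCommGroup Z] [NormedSpace ℝ Z] [CompleteSpace Z]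
    (hZ : IsMinimalSpace Z) (hc₀ : ¬ ContainsCopy CZero Z)
    (𝒜 : Set SB) (h𝒜 : IsAnalyticSubset 𝒜) (h𝒜sub : 𝒜 ⊆ NC Z ∩ NC EllOne) :
    ∃ ℬ : Set SB, ℬ ⊆ NC Z ∩ NC EllOne ∧
      IsAnalyticSubset ℬ ∧
      (∀ Y ∈ ℬ, Nonempty (SchauderBasis ℝ Y.space)) ∧
      (∀ X ∈ 𝒜, ∃ Y ∈ ℬ, IsQuotientOf X.space Y.space) := by
  refine ⟨_, ?_, isAnalyticSubset_image_windowSpace h𝒜, ?_, ?_⟩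
  · rintro _ ⟨d, hd, rfl⟩
    exact ⟨fun h => (h𝒜sub hd).1 (ContainsCopy.of_windowSpace hZ.embedsInFiniteCodim hc₀ h),
      fun h => (h𝒜sub hd).2 (ContainsCopy.of_windowSpace EllOne.embedsInFiniteCodim
        EllOne.not_containsCopy_cZero h)⟩
  · rintro _ ⟨d, -, rfl⟩
    exact windowSpace_schauderBasis d
  · intro X hX
    obtain ⟨d, rfl, hd, hdense⟩ := exists_dense_closedSpan X
    exact ⟨_, ⟨d, hX, rfl⟩, isQuotientOf_windowSpace hd hdense⟩
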